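/- Let $(S_n)_{n\in\mathbb N}$ be densely defined symmetric operators in complex Hilbert spaces $\mathfrak H_n$, and equip $\mathfrak H_{n+}:=\operatorname{dom}(S_n^*)$ with the graph norm $\|f\|_{\mathfrak H_{n+}}^2=\|f\|^2+\|S_n^*f\|^2$. For each $n$ let $\Pi_n=\{\mathcal H_n,\Gamma_0^{(n)},\Gamma_1^{(n)}\}$ be a boundary triplet for $S_n^*$: $\mathcal H_n$ is a Hilbert space, $\Gamma_0^{(n)},\Gamma_1^{(n)}:\mathfrak H_{n+}\to\mathcal H_n$ are bounded linear maps with $$(S_n^*f,g)-(f,S_n^*g)=(\Gamma_1^{(n)}f,\Gamma_0^{(n)}g)-(\Gamma_0^{(n)}f,\Gamma_1^{(n)}g),\qquad f,g\in\operatorname{dom}(S_n^*),$$ and $f\mapsto(\Gamma_0^{(n)}f,\Gamma_1^{(n)}f)$ maps $\operatorname{dom}(S_n^*)$ onto $\mathcal H_n\oplus\mathcal H_n$. Let $M_n(z)=\Gamma_1^{(n)}\bigl(\Gamma_0^{(n)}\!\upharpoonright\ker(S_n^*-z)\bigr)^{-1}$, $z\in\mathbb C\setminus\mathbb R$, be its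 Weyl function, and put $C_j=\sup_n\|\Gamma_j^{(n)}\|\in[0,\infty]$, $j=0,1$, with norms of maps $\mathfrak H_{n+}\to\mathcal H_n$. A direct sum $\bigoplus_n T_n$ of operators acts componentwise between the Hilbert direct sums, with domain $\{\oplus f_n: f_n\in\operatorname{dom}(T_n),\ \sum\|f_n\|^2<\infty,\ \sum\|T_nf_n\|^2<\infty\}$. Let $\mathfrak H=\bigoplus\mathfrak H_n$, $\mathcal H=\bigoplus\mathcal H_n$, $A=\bigoplus S_n$; then $A^*=\bigoplus S_n^*$. Let $\mathfrak H_+=\operatorname{dom}(A^*)$ with its graph norm. Define $$\Gamma_j=\bigoplus_n\Gamma_j^{(n)},\qquad \operatorname{dom}(\Gamma_j)=\Bigl\{f=\oplus f_n\in\operatorname{dom}(A^*):\sum_n\|\Gamma_j^{(n)}f_n\|^2<\infty\Bigr\},$$ $\Gamma=\{\Gamma_0,\Gamma_1\}$ on $\operatorname{dom}(\Gamma)=\operatorname{dom}(\Gamma_0)\cap\operatorname{dom}(\Gamma_1)$, $A_*=A^*\!\upharpoonright\operatorname{dom}(\Gamma)$, $A_{*j}=A_*\!\upharpoonright\ker\Gamma_j$,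 $S_{nj}=S_n^*\!\upharpoonright\ker\Gamma_j^{(n)}$, $\widetilde A_j=\bigoplus_nS_{nj}$; write $0'=1$, $1'=0$. Then: (i) $\Gamma$ is a single-valued boundary relation for $A^*$: $\operatorname{dom}(\Gamma)$ is dense in $\mathfrak H_+$; $(A_*f,g)-(f,A_*g)=(\Gamma_1f,\Gamma_0g)-(\Gamma_0f,\Gamma_1g)$ for $f,g\in\operatorname{dom}(\Gamma)$; and if $g,g'\in\mathfrak H$, $h,h'\in\mathcal H$ satisfy $(A_*f,g)-(f,g')=(\Gamma_1f,h)-(\Gamma_0f,h')$ for all $f\in\operatorname{dom}(\Gamma)$, then $g\in\operatorname{dom}(\Gamma)$ and $\Gamma g=\{h,h'\}$. (ii) For $z\in\mathbb C\setminus\mathbb R$ each $M_n(z)$ is a bounded everywhere defined operator in $\mathcal H_n$, and the Weyl function of $\Gamma$, i.e. the linear relation $M(z)=\{(\Gamma_0f,\Gamma_1f):f\in\operatorname{dom}(\Gamma),\ A^*f=zf\}$ in $\mathcal H$, is (the graph of) $M(z)=\bigoplus_nM_n(z)$. (iii) $\operatorname{ran}\Gamma$ is dense in $\mathcal H\oplus\mathcal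 H$. (iv) $\Gamma:\mathfrak H_+\to\mathcal H\oplus\mathcal H$ is closed, and $\Gamma_j:\mathfrak H_+\to\mathcal H$, $j=0,1$, are closable. (v) For the closure $\overline{\Gamma_j}$ of $\Gamma_j$, $j=0,1$, the following are equivalent: $\operatorname{dom}(\overline{\Gamma_j})=\mathfrak H_+$; $\overline{\Gamma_j}$ is a bounded operator from all of $\mathfrak H_+$ to $\mathcal H$; $C_j<\infty$. In particular $\operatorname{dom}(\Gamma)=\mathfrak H_+$ if and only if $\max\{C_0,C_1\}<\infty$. (vi) For $j=0,1$, $A_{*j}$ is essentially self-adjoint and $\overline{A_{*j}}=\widetilde A_j$. (vii) For $j=0,1$: if $C_{j'}<\infty$, then $A_{*j}$ is self-adjoint and $A_{*j}=\widetilde A_j$. If $\widetilde A_0$ and $\widetilde A_1$ are transversal, i.e. $\operatorname{dom}(\widetilde A_0)\cap\operatorname{dom}(\widetilde A_1)=\operatorname{dom}(\overline A)$ and $\operatorname{dom}(\widetilde A_0)+\operatorname{dom}(\widetilde A_1)=\operatorname{dom}(A^*)$, then $A_{*j}$ is self-adjoint if and only if $C_{j'}<\infty$. -/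

import Mathlib

open scoped LinearPMap

noncomputable section

namespace DirectSumTriplets

/-! ### The domain of an operator with its graph norm -/

section GraphDomain

variable {E F : Type*} [NormedAddCommGroup E] [InnerProductSpace ℂ E]
  [NormedAddCommGroup F] [InnerProductSpace ℂ F]

/-- The domain of a partially defined operator `T`; it carries the graph norm
`‖f‖₊² = ‖f‖² + ‖T f‖²`, see `GraphDom.norm_sq`. -/
def GraphDom (T : E →ₗ.[ℂ] F) : Type _ := T.domain

namespace GraphDom

variable (T : E →ₗ.[ℂ] F)

instance : AddCommGroup (GraphDom T) := inferInstanceAs (AddCommGroup T.domain)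

instance : Module ℂ (GraphDom T) := inferInstanceAs (Module ℂ T.domain)

/-- The identity map from the domain of `T` to the domain with the graph norm. -/
def ofDomain : T.domain ≃ₗ[ℂ] GraphDom T := LinearEquiv.refl ℂ T.domain

/-- The inclusion of the domain of `T` into the ambient space. -/
def incl : GraphDom T →ₗ[ℂ] E := T.domain.subtype ∘ₗ (ofDomain T).symm.toLinearMap

/-- The operator `T`, as a linear map on its domain. -/
def op : GraphDom T →ₗ[ℂ] F := T.toFun ∘ₗ (ofDomain T).symm.toLinearMap

/-- The map `f ↦ (f, T f)` into the Hilbert sum `E ⊕ F`. -/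
def toGraph : GraphDom T →ₗ[ℂ] WithLp 2 (E × F) :=
  (WithLp.linearEquiv 2 ℂ (E × F)).symm.toLinearMap ∘ₗ (incl T).prod (op T)

theorem toGraph_injective : Function.Injective (toGraph T) := by
  intro f g h
  have h' : incl T f = incl T g :=
    congrArg (fun p : WithLp 2 (E × F) => p.fst) h
  exact Subtype.ext h'

instance : NormedAddCommGroup (GraphDom T) :=
  NormedAddCommGroup.induced (GraphDom T) (WithLp 2 (E × F)) (toGraph T) (toGraph_injective T)

instance : NormedSpace ℂ (GraphDom T) :=
  NormedSpace.induced ℂ (GraphDom T) (WithLp 2 (E × F)) (toGraph T)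

theorem norm_sq (f : GraphDom T) : ‖f‖ ^ 2 = ‖incl T f‖ ^ 2 + ‖op T f‖ ^ 2 :=
  WithLp.prod_norm_sq_eq_of_L2 (toGraph T f)

end GraphDom

/-- The kernel of a partially defined operator, as a subspace of the ambient space. -/
def pmapKer {V W : Type*} [AddCommGroup V] [Module ℂ V] [AddCommGroup W] [Module ℂ W]
    (T : V →ₗ.[ℂ] W) : Submodule ℂ V :=
  (LinearMap.ker T.toFun).map T.domain.subtype

/-- The subspace `N_z = ker (T - z)` of the domain of `T`. -/
def eigenDom (T : E →ₗ.[ℂ] E) (z : ℂ) : Submodule ℂ (GraphDom T) :=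
  LinearMap.ker (GraphDom.op T - z • GraphDom.incl T)

/-- A partially defined operator is essentially self-adjoint if it is closable and its closure
is self-adjoint. -/
def IsEssentiallySelfAdjoint [CompleteSpace E] (T : E →ₗ.[ℂ] E) : Prop :=
  T.IsClosable ∧ IsSelfAdjoint T.closure

/-- Transversality of two proper extensions of a symmetric operator `A`: they are disjoint,
and their domains span the domain of `A†`. For a closed `A` one has `A.closure = A`. -/
structure IsTransversal [CompleteSpace E] (A A₀ A₁ : E →ₗ.[ℂ] E) : Prop where
  inf_eq : A₀.domain ⊓ A₁.domain = A.closure.domain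
  sup_eq : A₀.domain ⊔ A₁.domain = A†.domain

end GraphDomain

/-! ### Boundary triplets and boundary relations -/

section Boundary

variable {E : Type*} [NormedAddCommGroup E] [InnerProductSpace ℂ E] [CompleteSpace E]

/-- A boundary triplet `{G, Γ 0, Γ 1}` for `S†`. The maps `Γ j` are bounded for the graph norm.
Mathlib's `inner ℂ x y` is linear in `y`, so the scalar product `(x, y)`, linear in `x`, is
`inner ℂ y x`. -/
structure BoundaryTriplet (S : E →ₗ.[ℂ] E) (G : Type*) [NormedAddCommGroup G]
    [InnerProductSpace ℂ G] where
  Γ : Fin 2 → GraphDom S† →L[ℂ] G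
  green : ∀ f g : GraphDom S†,
    inner ℂ (GraphDom.incl S† g) (GraphDom.op S† f)
        - inner ℂ (GraphDom.op S† g) (GraphDom.incl S† f)
      = inner ℂ (Γ 0 g) (Γ 1 f) - inner ℂ (Γ 1 g) (Γ 0 f)
  surjective : Function.Surjective fun f : GraphDom S† => (Γ 0 f, Γ 1 f)

variable {G : Type*} [NormedAddCommGroup G] [InnerProductSpace ℂ G]

namespace BoundaryTriplet

variable {S : E →ₗ.[ℂ] E} (P : BoundaryTriplet S G)

/-- The `γ`-field `γ(z) = (Γ 0 ↾ N_z)⁻¹`. -/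
def gammaField (z : ℂ) : G →ₗ.[ℂ] GraphDom S† :=
  ((P.Γ 0 : GraphDom S† →ₗ[ℂ] G).toPMap (eigenDom S† z)).inverse

/-- The Weyl function `M(z) = Γ 1 γ(z)`. -/
def weyl (z : ℂ) : G →ₗ.[ℂ] G :=
  (P.Γ 1 : GraphDom S† →ₗ[ℂ] G).compPMap (P.gammaField z)

/-- The map `Γ j`, as a partially defined operator on the ambient Hilbert space with domain
`dom S†`. -/
def ΓPMap (j : Fin 2) : E →ₗ.[ℂ] G where
  domain := S†.domain
  toFun := (P.Γ j : GraphDom S† →ₗ[ℂ] G) ∘ₗ (GraphDom.ofDomain S†).toLinearMap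

/-- The extension `S_j = S† ↾ ker (Γ j)`. -/
def ext (j : Fin 2) : E →ₗ.[ℂ] E := S†.domRestrict (pmapKer (P.ΓPMap j))

end BoundaryTriplet

/-- A linear relation `Γ` from `E` to `G × G` is a boundary relation for `A†`, where `A` is a
densely defined symmetric operator: the domain of `Γ` is contained in `dom A†` and dense in it for
the graph norm, Green's identity holds on `Γ`, and `Γ` is maximal with this property. -/
structure IsBoundaryRelation (A : E →ₗ.[ℂ] E) (Γ : Submodule ℂ (E × (G × G))) : Prop where
  dense_domain : Dense (A.domain : Set E)
  symmetric : A.IsFormalAdjoint A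
  dom_le : Γ.map (LinearMap.fst ℂ E (G × G)) ≤ A†.domain
  dense : Dense {f : GraphDom A† | GraphDom.incl A† f ∈ Γ.map (LinearMap.fst ℂ E (G × G))}
  green : ∀ (f g : GraphDom A†) (l l' h h' : G),
    (GraphDom.incl A† f, (l, l')) ∈ Γ → (GraphDom.incl A† g, (h, h')) ∈ Γ →
    inner ℂ (GraphDom.incl A† g) (GraphDom.op A† f)
        - inner ℂ (GraphDom.op A† g) (GraphDom.incl A† f)
      = inner ℂ h l' - inner ℂ h' l
  maximal : ∀ (g g' : E) (h h' : G),
    (∀ (f : GraphDom A†) (l l' : G), (GraphDom.incl A† f, (l, l')) ∈ Γ →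
      inner ℂ g (GraphDom.op A† f) - inner ℂ g' (GraphDom.incl A† f)
        = inner ℂ h l' - inner ℂ h' l) →
    (g, (h, h')) ∈ Γ

/-- The value at `z` of the Weyl function (in general, Weyl family) of a boundary relation `Γ` for
`A†`: the linear relation `{(h, h') : (f, (h, h')) ∈ Γ for some f ∈ ker (A† - z)}` in `G`. -/
def weylRelation (A : E →ₗ.[ℂ] E) (Γ : Submodule ℂ (E × (G × G))) (z : ℂ) :
    Submodule ℂ (G × G) :=
  (Γ ⊓ ((eigenDom A† z).map (GraphDom.incl A†)).comap (LinearMap.fst ℂ E (G × G))).map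
    (LinearMap.snd ℂ E (G × G))

end Boundary

/-! ### Direct sums -/

section DirectSum

/-- The direct sum `⨁ T n` of partially defined operators between the Hilbert direct sums:
its domain consists of the `f` with `f n ∈ dom (T n)` and `∑ ‖T n (f n)‖² < ∞`. -/
def directSum {E F : ℕ → Type*}
    [∀ n, NormedAddCommGroup (E n)] [∀ n, InnerProductSpace ℂ (E n)]
    [∀ n, NormedAddCommGroup (F n)] [∀ n, InnerProductSpace ℂ (F n)]
    (T : ∀ n, E n →ₗ.[ℂ] F n) : lp E 2 →ₗ.[ℂ] lp F 2 where
  domain :=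
    { carrier := {f | ∃ h : ∀ n, f n ∈ (T n).domain, Memℓp (fun n => T n ⟨f n, h n⟩) 2}
      zero_mem' := ⟨fun n => (T n).domain.zero_mem, by
        convert (zero_memℓp : Memℓp (0 : ∀ n, F n) 2) using 1
        funext n
        exact (T n).map_zero⟩
      add_mem' := by
        rintro f g ⟨hf, hf'⟩ ⟨hg, hg'⟩
        refine ⟨fun n => (T n).domain.add_mem (hf n) (hg n), ?_⟩
        convert hf'.add hg' using 1
        funext n
        exact (T n).map_add ⟨f n, hf n⟩ ⟨g n, hg n⟩
      smul_mem' := by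
        rintro c f ⟨hf, hf'⟩
        refine ⟨fun n => (T n).domain.smul_mem c (hf n), ?_⟩
        convert hf'.const_smul c using 1
        funext n
        exact (T n).map_smul c ⟨f n, hf n⟩ }
  toFun :=
    { toFun := fun f => ⟨fun n => T n ⟨f.1 n, f.2.1 n⟩, f.2.2⟩
      map_add' := fun f g => by
        ext n
        exact (T n).map_add ⟨f.1 n, f.2.1 n⟩ ⟨g.1 n, g.2.1 n⟩
      map_smul' := fun c f => by
        ext n
        exact (T n).map_smul c ⟨f.1 n, f.2.1 n⟩ }

variable {H : ℕ → Type*} {K : ℕ → Type*}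
  [∀ n, NormedAddCommGroup (H n)] [∀ n, InnerProductSpace ℂ (H n)] [∀ n, CompleteSpace (H n)]
  [∀ n, NormedAddCommGroup (K n)] [∀ n, InnerProductSpace ℂ (K n)]
  {S : ∀ n, H n →ₗ.[ℂ] H n} (P : ∀ n, BoundaryTriplet (S n) (K n))

/-- The map `Γ_j = ⨁ Γ_j^(n)` from `dom A†` (with its graph norm) to `⨁ K n`, where `A = ⨁ S n`:
its domain consists of the `f ∈ dom A†` with `∑ ‖Γ_j^(n) (f n)‖² < ∞`. -/
def sumΓ (j : Fin 2) : GraphDom (directSum S)† →ₗ.[ℂ] lp K 2 where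
  domain := (directSum fun n => (P n).ΓPMap j).domain.comap (GraphDom.incl (directSum S)†)
  toFun := (directSum fun n => (P n).ΓPMap j).toFun ∘ₗ
    (GraphDom.incl (directSum S)†).restrict fun _ hf => hf

/-- The map `Γ = {Γ_0, Γ_1}` on `dom Γ_0 ∩ dom Γ_1`. -/
def sumΓPair : GraphDom (directSum S)† →ₗ.[ℂ] lp K 2 × lp K 2 where
  domain := (sumΓ P 0).domain ⊓ (sumΓ P 1).domain
  toFun := ((sumΓ P 0).toFun ∘ₗ Submodule.inclusion inf_le_left).prod
    ((sumΓ P 1).toFun ∘ₗ Submodule.inclusion inf_le_right)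

/-- The map `Γ = {Γ_0, Γ_1}` as a linear relation from `⨁ H n` to `(⨁ K n) × (⨁ K n)`. -/
def sumΓRel : Submodule ℂ (lp H 2 × (lp K 2 × lp K 2)) :=
  (sumΓPair P).graph.map ((GraphDom.incl (directSum S)†).prodMap LinearMap.id)

/-- The operator `A_* = A† ↾ dom Γ`. -/
def Astar : lp H 2 →ₗ.[ℂ] lp H 2 :=
  (directSum S)†.domRestrict ((sumΓPair P).domain.map (GraphDom.incl (directSum S)†))

/-- The operator `A_{*j} = A_* ↾ ker Γ_j`. -/
def AstarExt (j : Fin 2) : lp H 2 →ₗ.[ℂ] lp H 2 :=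
  (Astar P).domRestrict ((pmapKer (sumΓ P j)).map (GraphDom.incl (directSum S)†))

/-- The operator `Ã_j = ⨁ S_{nj}`, where `S_{nj} = S_n† ↾ ker Γ_j^(n)`. -/
def Atilde (j : Fin 2) : lp H 2 →ₗ.[ℂ] lp H 2 := directSum fun n => (P n).ext j

/-- The condition `C_j = sup_n ‖Γ_j^(n)‖ < ∞`. -/
def SupFinite (j : Fin 2) : Prop := BddAbove (Set.range fun n => ‖(P n).Γ j‖)

end DirectSum

end DirectSumTriplets

end

/-!
Because the adjoint commutes with direct sums, `dom A†` consists of the sequences of elements of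
`dom (S n)†` that are square-summable in the graph norm, and membership in the graphs of `Γ`,
`A_{*j}` and `Ã_j` is read off from the sequence of boundary values alone. Finitely supported
sequences approximate every element in the graph norm, which gives the density statements and
`closure A_{*j} = Ã_j`; the latter is self-adjoint because each `S_{nj}` is. For the Weyl function,
Green's identity on `ker ((S n)† - z)` reads `Im z ‖f‖² = Im (Γ₁ f, Γ₀ f)`, so square-summable
boundary values force a square-summable sequence of eigenvectors. Finally `Γ_j` is closed, hence
bounded as soon as it is everywhere defined, and restricting it to a single summand bounds
`‖Γ_j^(n)‖` by `‖Γ_j‖`.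
-/

noncomputable section

namespace DirectSumTriplets

/-! ### Closed operators and the graph norm -/

theorem mem_topologicalClosure_of_hasSum {R V ι : Type*} [Semiring R] [TopologicalSpace V]
    [AddCommMonoid V] [Module R V] [ContinuousAdd V] [ContinuousConstSMul R V]
    {p : Submodule R V} {u : ι → V} {x : V} (hu : ∀ i, u i ∈ p.topologicalClosure)
    (hx : HasSum u x) : x ∈ p.topologicalClosure :=
  p.isClosed_topologicalClosure.mem_of_tendsto hx
    (Filter.Eventually.of_forall fun _ => Submodule.sum_mem _ fun i _ => hu i)

theorem memℓp_two_iff {ι : Type*} {E : ι → Type*} [∀ i, NormedAddCommGroup (E i)]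
    {f : ∀ i, E i} : Memℓp f 2 ↔ Summable fun i => ‖f i‖ ^ 2 := by
  rw [memℓp_gen_iff (by simp)]
  simp

section ClosedOperators

variable {𝕜 V W : Type*} [NontriviallyNormedField 𝕜] [NormedAddCommGroup V] [NormedSpace 𝕜 V]
  [NormedAddCommGroup W] [NormedSpace 𝕜 W] {T : V →ₗ.[𝕜] W}

theorem closure_eq_of_isClosed (hT : T.IsClosed) : T.closure = T := by
  refine LinearPMap.eq_of_eq_graph ?_
  rw [← hT.isClosable.graph_closure_eq_closure_graph]
  exact hT.submodule_topologicalClosure_eq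

theorem exists_eq_toPMap_of_isClosed [CompleteSpace V] [CompleteSpace W] (hT : T.IsClosed)
    (hdom : T.domain = ⊤) : ∃ B : V →L[𝕜] W, T = (B : V →ₗ[𝕜] W).toPMap ⊤ := by
  let L : V →ₗ[𝕜] W := T.toFun ∘ₗ (LinearEquiv.ofTop _ hdom).symm.toLinearMap
  have hTL : T = L.toPMap ⊤ := LinearPMap.ext hdom fun _ _ _ => rfl
  have hgraph : (L.graph : Set (V × W)) = T.graph := by
    ext ⟨x, y⟩
    rw [SetLike.mem_coe, SetLike.mem_coe, hTL, LinearPMap.mem_graph_iff, LinearMap.mem_graph_iff]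
    exact ⟨fun h => ⟨⟨x, trivial⟩, rfl, h.symm⟩, fun ⟨u, hu, hy⟩ => hy.symm.trans (hu ▸ rfl)⟩
  exact ⟨⟨L, L.continuous_of_isClosed_graph (hgraph ▸ hT)⟩, hTL⟩

end ClosedOperators

theorem mem_pmapKer_iff {V W : Type*} [AddCommGroup V] [Module ℂ V] [AddCommGroup W] [Module ℂ W]
    {T : V →ₗ.[ℂ] W} {x : V} : x ∈ pmapKer T ↔ (x, 0) ∈ T.graph := by
  rw [LinearPMap.mem_graph_iff]
  constructor
  · rintro ⟨u, hu, rfl⟩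
    exact ⟨u, rfl, hu⟩
  · rintro ⟨u, rfl, hu⟩
    exact ⟨u, hu, rfl⟩

theorem mem_graph_domRestrict_iff {R V W : Type*} [Ring R] [AddCommGroup V] [Module R V]
    [AddCommGroup W] [Module R W] {T : V →ₗ.[R] W} {p : Submodule R V} {x : V} {y : W} :
    (x, y) ∈ (T.domRestrict p).graph ↔ x ∈ p ∧ (x, y) ∈ T.graph := by
  constructor
  · intro h
    exact ⟨(LinearPMap.mem_domain_of_mem_graph h).1,
      LinearPMap.le_graph_of_le LinearPMap.domRestrict_le h⟩
  · rintro ⟨hx, h⟩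
    obtain ⟨u, rfl, rfl⟩ := T.mem_graph_iff.1 h
    exact (T.domRestrict p).mem_graph_iff.2
      ⟨⟨u, hx, u.2⟩, rfl, LinearPMap.domRestrict_apply rfl⟩

section GraphNorm

variable {E F : Type*} [NormedAddCommGroup E] [InnerProductSpace ℂ E]
  [NormedAddCommGroup F] [InnerProductSpace ℂ F]

theorem mem_graph_adjoint_iff [CompleteSpace E] {T : E →ₗ.[ℂ] F}
    (hT : Dense (T.domain : Set E)) {y : F} {w : E} :
    (y, w) ∈ T†.graph ↔ ∀ x x', (x, x') ∈ T.graph → inner ℂ w x = inner ℂ y x' := by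
  constructor
  · intro h x x' hx
    obtain ⟨u, rfl, rfl⟩ := T†.mem_graph_iff.1 h
    obtain ⟨v, rfl, rfl⟩ := T.mem_graph_iff.1 hx
    exact LinearPMap.adjoint_isFormalAdjoint hT u v
  · intro h
    have hw (x : T.domain) : inner ℂ w (x : E) = inner ℂ y (T x) := h x _ (T.mem_graph x)
    have hy : y ∈ T†.domain := LinearPMap.mem_adjoint_domain_of_exists y ⟨w, hw⟩
    exact T†.mem_graph_iff.2 ⟨⟨y, hy⟩, rfl, LinearPMap.adjoint_apply_eq hT ⟨y, hy⟩ hw⟩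

namespace GraphDom

variable {T : E →ₗ.[ℂ] F}

theorem mem_graph (f : GraphDom T) : (incl T f, op T f) ∈ T.graph :=
  T.mem_graph ((ofDomain T).symm f)

theorem exists_of_mem_graph {x : E} {y : F} (h : (x, y) ∈ T.graph) :
    ∃ f : GraphDom T, incl T f = x ∧ op T f = y := by
  obtain ⟨u, hu, hu'⟩ := T.mem_graph_iff.1 h
  exact ⟨ofDomain T u, hu, hu'⟩

theorem incl_mem_domain (f : GraphDom T) : incl T f ∈ T.domain :=
  LinearPMap.mem_domain_of_mem_graph (mem_graph f)

theorem incl_injective : Function.Injective (incl T) :=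
  fun _ _ h => Subtype.ext h

theorem eq_op_of_mem_graph {f : GraphDom T} {y : F} (h : (incl T f, y) ∈ T.graph) :
    y = op T f :=
  T.mem_graph_snd_inj h (mem_graph f) rfl

theorem norm_le_add (f : GraphDom T) : ‖f‖ ≤ ‖incl T f‖ + ‖op T f‖ := by
  refine le_of_sq_le_sq ?_ (by positivity)
  rw [norm_sq]
  nlinarith [mul_nonneg (norm_nonneg (incl T f)) (norm_nonneg (op T f))]

variable (T) in
theorem isInducing_incl_op : Topology.IsInducing ((incl T).prod (op T)) :=
  (WithLp.homeomorphProd 2 E F).isInducing.comp ⟨rfl⟩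

variable (T) in
theorem continuous_incl : Continuous (incl T) :=
  continuous_fst.comp (isInducing_incl_op T).continuous

variable (T) in
theorem continuous_op : Continuous (op T) :=
  continuous_snd.comp (isInducing_incl_op T).continuous

theorem hasSum_of_incl_op {ι : Type*} {u : ι → GraphDom T} {f : GraphDom T}
    (hincl : HasSum (fun i => incl T (u i)) (incl T f))
    (hop : HasSum (fun i => op T (u i)) (op T f)) : HasSum u f := by
  have h : HasSum (fun i => (incl T (u i), op T (u i))) (incl T f, op T f) := hincl.prodMk hop
  exact ((isInducing_incl_op T).hasSum_iff u f).1 h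

theorem completeSpace [CompleteSpace E] [CompleteSpace F] (hT : T.IsClosed) :
    CompleteSpace (GraphDom T) := by
  have hrange : Set.range (toGraph T) = WithLp.homeomorphProd 2 E F ⁻¹' T.graph := by
    ext p
    constructor
    · rintro ⟨f, rfl⟩
      exact mem_graph f
    · intro hp
      obtain ⟨f, hincl, hop⟩ := exists_of_mem_graph (T := T) hp
      exact ⟨f, (WithLp.homeomorphProd 2 E F).injective (Prod.ext hincl hop)⟩
  have htoGraph : IsUniformInducing (toGraph T) := ⟨rfl⟩
  rw [completeSpace_iff_isComplete_range htoGraph, hrange]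
  exact (IsClosed.preimage (WithLp.homeomorphProd 2 E F).continuous hT).isComplete

end GraphDom

end GraphNorm

section Symmetric

open GraphDom

variable {E : Type*} [NormedAddCommGroup E] [InnerProductSpace ℂ E] {T : E →ₗ.[ℂ] E} {z : ℂ}

theorem mem_eigenDom_iff {f : GraphDom T} : f ∈ eigenDom T z ↔ op T f = z • incl T f := by
  rw [eigenDom, LinearMap.mem_ker, LinearMap.sub_apply, LinearMap.smul_apply, sub_eq_zero]

variable (T z) in
/-- The operator `T - z`, bounded from the domain of `T` with the graph norm. -/
def GraphDom.opSub : GraphDom T →L[ℂ] E :=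
  ⟨op T - z • incl T, (continuous_op T).sub ((continuous_incl T).const_smul z)⟩

theorem GraphDom.opSub_apply (f : GraphDom T) : opSub T z f = op T f - z • incl T f := rfl

theorem im_inner_op_eq_zero (hT : T.IsFormalAdjoint T) (f : GraphDom T) :
    (inner ℂ (incl T f) (op T f)).im = 0 := by
  have hsymm : inner ℂ (op T f) (incl T f) = inner ℂ (incl T f) (op T f) :=
    hT ((ofDomain T).symm f) ((ofDomain T).symm f)
  rwa [← inner_conj_symm, Complex.conj_eq_iff_im] at hsymm

theorem abs_im_mul_norm_incl_le (hT : T.IsFormalAdjoint T) (f : GraphDom T) :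
    |z.im| * ‖incl T f‖ ≤ ‖opSub T z f‖ := by
  have him : (inner ℂ (incl T f) (opSub T z f)).im = -(z.im * ‖incl T f‖ ^ 2) := by
    rw [opSub_apply, inner_sub_right, inner_smul_right, inner_self_eq_norm_sq_to_K,
      Complex.sub_im, im_inner_op_eq_zero hT]
    simp [← Complex.ofReal_pow]
  have hCS : ‖incl T f‖ * (|z.im| * ‖incl T f‖) ≤ ‖incl T f‖ * ‖opSub T z f‖ :=
    calc ‖incl T f‖ * (|z.im| * ‖incl T f‖) = |(inner ℂ (incl T f) (opSub T z f)).im| := by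
          rw [him, abs_neg, abs_mul, abs_of_nonneg (sq_nonneg ‖incl T f‖)]
          ring
      _ ≤ ‖inner ℂ (incl T f) (opSub T z f)‖ := Complex.abs_im_le_norm _
      _ ≤ ‖incl T f‖ * ‖opSub T z f‖ := norm_inner_le_norm _ _
  rcases (norm_nonneg (incl T f)).eq_or_lt with h | h
  · rw [← h, mul_zero]
    exact norm_nonneg _
  · exact le_of_mul_le_mul_left hCS h

theorem norm_le_mul_norm_opSub (hT : T.IsFormalAdjoint T) (hz : z.im ≠ 0) (f : GraphDom T) :
    ‖f‖ ≤ (1 + (1 + ‖z‖) / |z.im|) * ‖opSub T z f‖ := by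
  have hincl : ‖incl T f‖ ≤ ‖opSub T z f‖ / |z.im| := by
    rw [le_div_iff₀ (abs_pos.2 hz), mul_comm]
    exact abs_im_mul_norm_incl_le hT f
  have hop : ‖op T f‖ ≤ ‖opSub T z f‖ + ‖z‖ * ‖incl T f‖ := by
    rw [← norm_smul, opSub_apply]
    exact norm_le_norm_sub_add _ _
  calc ‖f‖ ≤ ‖incl T f‖ + ‖op T f‖ := norm_le_add f
    _ ≤ ‖opSub T z f‖ + (1 + ‖z‖) * ‖incl T f‖ := by linarith
    _ ≤ ‖opSub T z f‖ + (1 + ‖z‖) * (‖opSub T z f‖ / |z.im|) := by gcongr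
    _ = (1 + (1 + ‖z‖) / |z.im|) * ‖opSub T z f‖ := by ring

theorem isClosed_range_opSub [CompleteSpace E] (hT : T.IsFormalAdjoint T) (hcl : T.IsClosed)
    (hz : z.im ≠ 0) : IsClosed (Set.range (opSub T z)) := by
  have : CompleteSpace (GraphDom T) := GraphDom.completeSpace hcl
  have hbound (f : GraphDom T) :
      ‖f‖ ≤ (1 + (1 + ‖z‖) / |z.im|).toNNReal * ‖opSub T z f‖ := by
    rw [Real.coe_toNNReal _ (by positivity)]
    exact norm_le_mul_norm_opSub hT hz f
  exact ((opSub T z).antilipschitz_of_bound hbound).isClosed_range (opSub T z).uniformContinuous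

theorem mem_graph_adjoint_of_mem_range_opSub_orthogonal [CompleteSpace E]
    (hT : Dense (T.domain : Set E)) {g : E} (hg : g ∈ (opSub T z).rangeᗮ) :
    (g, star z • g) ∈ T†.graph := by
  refine (mem_graph_adjoint_iff hT).2 fun x x' hx => ?_
  obtain ⟨f, rfl, rfl⟩ := exists_of_mem_graph hx
  have horth : inner ℂ g (op T f - z • incl T f) = 0 :=
    (Submodule.mem_orthogonal' _ g).1 hg _ ⟨f, rfl⟩
  rw [inner_sub_right, sub_eq_zero, inner_smul_right] at horth
  rw [horth, inner_smul_left, Complex.star_def, Complex.conj_conj]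

theorem surjective_opSub [CompleteSpace E] (hT : IsSelfAdjoint T) (hz : z.im ≠ 0) :
    Function.Surjective (opSub T z) := by
  have hadj : T† = T := LinearPMap.isSelfAdjoint_def.1 hT
  have hsymm : T.IsFormalAdjoint T := by
    simpa only [hadj] using LinearPMap.adjoint_isFormalAdjoint hT.dense_domain
  have hcl : IsClosed ((opSub T z).range : Set E) := isClosed_range_opSub hsymm hT.isClosed hz
  have hbot : (opSub T z).rangeᗮ = ⊥ := by
    refine (Submodule.eq_bot_iff _).2 fun g hg => ?_
    have hmem := mem_graph_adjoint_of_mem_range_opSub_orthogonal hT.dense_domain hg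
    rw [hadj] at hmem
    obtain ⟨f, rfl, hf⟩ := exists_of_mem_graph hmem
    have hle := abs_im_mul_norm_incl_le (z := star z) hsymm f
    rw [opSub_apply, hf, sub_self, norm_zero] at hle
    have hz' : 0 < |(star z).im| := by simpa using hz
    exact norm_le_zero_iff.1 (nonpos_of_mul_nonpos_right hle hz')
  rw [← Submodule.topologicalClosure_eq_top_iff, hcl.submodule_topologicalClosure_eq] at hbot
  exact LinearMap.range_eq_top.1 hbot

end Symmetric

/-! ### Componentwise description of direct sums -/

section DirectSumOfOperators

variable {E F : ℕ → Type*}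
  [∀ n, NormedAddCommGroup (E n)] [∀ n, InnerProductSpace ℂ (E n)]
  [∀ n, NormedAddCommGroup (F n)] [∀ n, InnerProductSpace ℂ (F n)]
  {T : ∀ n, E n →ₗ.[ℂ] F n}

theorem mem_graph_directSum_iff {f : lp E 2} {g : lp F 2} :
    (f, g) ∈ (directSum T).graph ↔ ∀ n, (f n, g n) ∈ (T n).graph := by
  constructor
  · intro h n
    obtain ⟨u, rfl, rfl⟩ := (directSum T).mem_graph_iff.1 h
    exact (T n).mem_graph ⟨u.1 n, u.2.1 n⟩
  · intro h
    have hf (n) : f n ∈ (T n).domain := LinearPMap.mem_domain_of_mem_graph (h n)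
    have hg : (fun n => T n ⟨f n, hf n⟩) = g :=
      funext fun n => ((LinearPMap.image_iff (hf n)).2 (h n)).symm
    have hmem : f ∈ (directSum T).domain := ⟨hf, hg ▸ lp.memℓp g⟩
    exact (directSum T).mem_graph_iff.2 ⟨⟨f, hmem⟩, rfl, lp.ext hg⟩

theorem single_mem_graph_directSum {n : ℕ} {x : E n} {y : F n} (h : (x, y) ∈ (T n).graph) :
    (lp.single 2 n x, lp.single 2 n y) ∈ (directSum T).graph := by
  refine mem_graph_directSum_iff.2 fun m => ?_
  rcases eq_or_ne m n with rfl | hm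
  · simpa only [lp.single_apply_self] using h
  · simp only [lp.single_apply_ne _ _ _ hm]
    exact (T m).graph.zero_mem

theorem dense_directSum_domain (hT : ∀ n, Dense ((T n).domain : Set (E n))) :
    Dense ((directSum T).domain : Set (lp E 2)) := by
  suffices h : ∀ f, f ∈ (directSum T).domain.topologicalClosure from h
  refine fun f => mem_topologicalClosure_of_hasSum (fun n => ?_) (lp.hasSum_single (by simp) f)
  refine map_mem_closure (lp.isometry_single n).continuous (hT n (f n)) fun x hx => ?_
  exact LinearPMap.mem_domain_of_mem_graph
    (single_mem_graph_directSum ((T n).mem_graph ⟨x, hx⟩))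

theorem adjoint_directSum [∀ n, CompleteSpace (E n)]
    (hT : ∀ n, Dense ((T n).domain : Set (E n))) :
    (directSum T)† = directSum fun n => (T n)† := by
  refine LinearPMap.eq_of_eq_graph (SetLike.ext ?_)
  rintro ⟨g, g'⟩
  rw [mem_graph_adjoint_iff (T := directSum T) (dense_directSum_domain hT),
    mem_graph_directSum_iff]
  constructor
  · refine fun h n => (mem_graph_adjoint_iff (hT n)).2 fun x x' hx => ?_
    simpa only [lp.inner_single_right] using h _ _ (single_mem_graph_directSum hx)
  · intro h f f' hf
    rw [lp.inner_eq_tsum, lp.inner_eq_tsum]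
    exact tsum_congr fun n =>
      (mem_graph_adjoint_iff (hT n)).1 (h n) _ _ (mem_graph_directSum_iff.1 hf n)

theorem isFormalAdjoint_directSum {R : ∀ n, F n →ₗ.[ℂ] E n}
    (h : ∀ n, (T n).IsFormalAdjoint (R n)) : (directSum T).IsFormalAdjoint (directSum R) := by
  intro f g
  rw [lp.inner_eq_tsum, lp.inner_eq_tsum]
  exact tsum_congr fun n => h n ⟨f.1 n, f.2.1 n⟩ ⟨g.1 n, g.2.1 n⟩

namespace GraphDom

-- `A` stands for `(⨁ S n)†`, which equals `⨁ (S n)†` only propositionally; carrying the equation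
-- `hA` avoids transporting elements of the domain along it.
variable {A : lp E 2 →ₗ.[ℂ] lp F 2} (hA : A = directSum T)

include hA in
theorem apply_mem_graph (f : GraphDom A) (n : ℕ) : (incl A f n, op A f n) ∈ (T n).graph := by
  subst hA
  exact mem_graph_directSum_iff.1 (mem_graph f) n

/-- The `n`-th component of an element of the domain of `⨁ T n`. -/
def comp (n : ℕ) : GraphDom A →ₗ[ℂ] GraphDom (T n) where
  toFun f := ofDomain (T n)
    ⟨incl A f n, LinearPMap.mem_domain_of_mem_graph (apply_mem_graph hA f n)⟩
  map_add' _ _ := incl_injective rfl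
  map_smul' _ _ := incl_injective rfl

@[simp]
theorem incl_comp (n : ℕ) (f : GraphDom A) : incl (T n) (comp hA n f) = incl A f n := rfl

@[simp]
theorem op_comp (n : ℕ) (f : GraphDom A) : op (T n) (comp hA n f) = op A f n :=
  (eq_op_of_mem_graph (f := comp hA n f) (apply_mem_graph hA f n)).symm

theorem continuous_comp (n : ℕ) : Continuous (comp hA n) := by
  refine (isInducing_incl_op (T n)).continuous_iff.2 (Continuous.prodMk ?_ ?_)
  · exact (lp.evalCLM ℂ E 2 n).continuous.comp (continuous_incl A)
  · simp only [op_comp]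
    exact (lp.evalCLM ℂ F 2 n).continuous.comp (continuous_op A)

theorem summable_norm_comp_sq (f : GraphDom A) : Summable fun n => ‖comp hA n f‖ ^ 2 := by
  simp only [norm_sq, incl_comp, op_comp]
  exact (memℓp_two_iff.1 (lp.memℓp _)).add (memℓp_two_iff.1 (lp.memℓp _))

theorem exists_comp_eq {x : lp E 2} {y : lp F 2} (u : ∀ n, GraphDom (T n))
    (hx : ∀ n, incl (T n) (u n) = x n) (hy : ∀ n, op (T n) (u n) = y n) :
    ∃ f : GraphDom A, incl A f = x ∧ op A f = y ∧ ∀ n, comp hA n f = u n := by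
  have hxy : (x, y) ∈ A.graph := by
    rw [hA, mem_graph_directSum_iff]
    exact fun n => hx n ▸ hy n ▸ mem_graph (u n)
  obtain ⟨f, rfl, rfl⟩ := exists_of_mem_graph hxy
  exact ⟨f, rfl, rfl, fun n => incl_injective (hx n).symm⟩

/-- The embedding of the domain of `T n` into the domain of `⨁ T n` as the `n`-th summand. -/
def single (n : ℕ) : GraphDom (T n) →ₗ[ℂ] GraphDom A where
  toFun u := ofDomain A ⟨lp.single 2 n (incl (T n) u), by
    rw [hA]
    exact LinearPMap.mem_domain_of_mem_graph (single_mem_graph_directSum (mem_graph u))⟩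
  map_add' _ _ := incl_injective (by simp [incl, lp.single_add])
  map_smul' _ _ := incl_injective (by simp [incl, lp.single_smul])

@[simp]
theorem incl_single (n : ℕ) (u : GraphDom (T n)) :
    incl A (single hA n u) = lp.single 2 n (incl (T n) u) := rfl

@[simp]
theorem op_single (n : ℕ) (u : GraphDom (T n)) :
    op A (single hA n u) = lp.single 2 n (op (T n) u) := by
  refine (eq_op_of_mem_graph ?_).symm
  rw [incl_single]
  subst hA
  exact single_mem_graph_directSum (mem_graph u)

@[simp]
theorem comp_single_same (n : ℕ) (u : GraphDom (T n)) : comp hA n (single hA n u) = u :=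
  incl_injective (by simp)

theorem comp_single_of_ne {m n : ℕ} (h : m ≠ n) (u : GraphDom (T n)) :
    comp hA m (single hA n u) = 0 :=
  incl_injective (by simp [h])

theorem norm_single (n : ℕ) (u : GraphDom (T n)) : ‖single hA n u‖ = ‖u‖ := by
  rw [← sq_eq_sq₀ (norm_nonneg _) (norm_nonneg _), norm_sq, norm_sq, incl_single, op_single,
    lp.norm_single (by simp), lp.norm_single (by simp)]

theorem hasSum_single_comp (f : GraphDom A) : HasSum (fun n => single hA n (comp hA n f)) f := by
  refine hasSum_of_incl_op ?_ ?_
  · simpa only [incl_single, incl_comp] using lp.hasSum_single (by simp) (incl A f)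
  · simpa only [op_single, op_comp] using lp.hasSum_single (by simp) (op A f)

end GraphDom

end DirectSumOfOperators

section EigenspacesOfDirectSums

open GraphDom

variable {E : ℕ → Type*} [∀ n, NormedAddCommGroup (E n)] [∀ n, InnerProductSpace ℂ (E n)]
  {T : ∀ n, E n →ₗ.[ℂ] E n} {A : lp E 2 →ₗ.[ℂ] lp E 2} (hA : A = directSum T) {z : ℂ}

theorem mem_eigenDom_iff_comp {f : GraphDom A} :
    f ∈ eigenDom A z ↔ ∀ n, comp hA n f ∈ eigenDom (T n) z := by
  simp only [mem_eigenDom_iff, op_comp, incl_comp]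
  exact ⟨fun h n => congrArg (fun x : lp E 2 => x n) h, fun h => lp.ext (funext h)⟩

theorem exists_mem_eigenDom_comp_eq {u : ∀ n, GraphDom (T n)} (hu : ∀ n, u n ∈ eigenDom (T n) z)
    (hsum : Memℓp (fun n => incl (T n) (u n)) 2) :
    ∃ f ∈ eigenDom A z, ∀ n, comp hA n f = u n := by
  let x : lp E 2 := ⟨_, hsum⟩
  obtain ⟨f, -, -, hf⟩ :=
    exists_comp_eq hA (x := x) (y := z • x) u (fun _ => rfl) fun n => mem_eigenDom_iff.1 (hu n)
  exact ⟨f, (mem_eigenDom_iff_comp hA).2 fun n => hf n ▸ hu n, hf⟩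

end EigenspacesOfDirectSums

/-! ### A single boundary triplet -/

namespace BoundaryTriplet

open GraphDom
open scoped ComplexConjugate

variable {E : Type*} [NormedAddCommGroup E] [InnerProductSpace ℂ E] [CompleteSpace E]
  {G : Type*} [NormedAddCommGroup G] [InnerProductSpace ℂ G]
  {S : E →ₗ.[ℂ] E} (P : BoundaryTriplet S G)

theorem exists_Γ_eq (j : Fin 2) (a b : G) : ∃ f, P.Γ j f = a ∧ P.Γ (1 - j) f = b := by
  fin_cases j
  · obtain ⟨f, hf⟩ := P.surjective (a, b)
    exact ⟨f, congrArg Prod.fst hf, congrArg Prod.snd hf⟩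
  · obtain ⟨f, hf⟩ := P.surjective (b, a)
    exact ⟨f, congrArg Prod.snd hf, congrArg Prod.fst hf⟩

theorem neg_one_pow_mul_green (j : Fin 2) (f g : GraphDom S†) :
    (-1) ^ (j : ℕ) * (inner ℂ (incl S† g) (op S† f) - inner ℂ (op S† g) (incl S† f))
      = inner ℂ (P.Γ j g) (P.Γ (1 - j) f) - inner ℂ (P.Γ (1 - j) g) (P.Γ j f) := by
  fin_cases j <;> simp [P.green]

theorem eq_of_forall_inner_sub_eq {h h' l l' : G}
    (hinner : ∀ f, inner ℂ h (P.Γ 1 f) - inner ℂ h' (P.Γ 0 f)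
      = inner ℂ l (P.Γ 1 f) - inner ℂ l' (P.Γ 0 f)) : h = l ∧ h' = l' := by
  constructor
  · refine ext_inner_right ℂ fun v => ?_
    obtain ⟨f, h₁, h₀⟩ : ∃ f, P.Γ 1 f = v ∧ P.Γ 0 f = 0 := P.exists_Γ_eq 1 v 0
    simpa [h₀, h₁] using hinner f
  · refine ext_inner_right ℂ fun v => ?_
    obtain ⟨f, h₀, h₁⟩ : ∃ f, P.Γ 0 f = v ∧ P.Γ 1 f = 0 := P.exists_Γ_eq 0 v 0
    simpa [h₀, h₁] using hinner f

theorem Γ_eq_zero_of_mem_graph (hS : Dense (S.domain : Set E)) {f : GraphDom S†}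
    (hf : (incl S† f, op S† f) ∈ S.graph) (j : Fin 2) : P.Γ j f = 0 := by
  have hinner (g) : inner ℂ (P.Γ 0 f) (P.Γ 1 g) - inner ℂ (P.Γ 1 f) (P.Γ 0 g)
      = inner ℂ 0 (P.Γ 1 g) - inner ℂ 0 (P.Γ 0 g) := by
    have hadj := (mem_graph_adjoint_iff hS).1 (GraphDom.mem_graph g) _ _ hf
    rw [← P.green g f, ← inner_conj_symm, hadj, inner_conj_symm]
    simp
  obtain ⟨h₀, h₁⟩ := P.eq_of_forall_inner_sub_eq hinner
  fin_cases j
  exacts [h₀, h₁]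

theorem exists_Γ_eq_zero (hS : Dense (S.domain : Set E)) (hsymm : S.IsFormalAdjoint S) {x x' : E}
    (hx : (x, x') ∈ S.graph) :
    ∃ f : GraphDom S†, incl S† f = x ∧ op S† f = x' ∧ ∀ j, P.Γ j f = 0 := by
  obtain ⟨f, rfl, rfl⟩ :=
    exists_of_mem_graph (LinearPMap.le_graph_of_le (hsymm.le_adjoint hS) hx)
  exact ⟨f, rfl, rfl, P.Γ_eq_zero_of_mem_graph hS hx⟩

theorem exists_of_green (hS : Dense (S.domain : Set E)) (hsymm : S.IsFormalAdjoint S)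
    {g g' : E} {h h' : G}
    (hinner : ∀ f : GraphDom S†, inner ℂ g (op S† f) - inner ℂ g' (incl S† f)
      = inner ℂ h (P.Γ 1 f) - inner ℂ h' (P.Γ 0 f)) :
    ∃ u : GraphDom S†, incl S† u = g ∧ op S† u = g' ∧ P.Γ 0 u = h ∧ P.Γ 1 u = h' := by
  have hg : (g, g') ∈ S†.graph := by
    refine (mem_graph_adjoint_iff hS).2 fun x x' hx => ?_
    obtain ⟨f, rfl, rfl, hf⟩ := P.exists_Γ_eq_zero hS hsymm hx
    have hzero := hinner f
    rw [hf, hf, inner_zero_right, inner_zero_right, sub_zero, sub_eq_zero] at hzero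
    exact hzero.symm
  obtain ⟨u, rfl, rfl⟩ := exists_of_mem_graph hg
  exact ⟨u, rfl, rfl, P.eq_of_forall_inner_sub_eq fun f => (P.green f u).symm.trans (hinner f)⟩

theorem mem_graph_ext_iff {j : Fin 2} {x y : E} :
    (x, y) ∈ (P.ext j).graph ↔ ∃ u : GraphDom S†, incl S† u = x ∧ op S† u = y ∧ P.Γ j u = 0 := by
  rw [ext, mem_graph_domRestrict_iff]
  constructor
  · rintro ⟨⟨w, hw, rfl⟩, h⟩
    obtain ⟨u, hu, rfl⟩ := exists_of_mem_graph h
    obtain rfl : u = ofDomain S† w := incl_injective hu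
    exact ⟨_, rfl, rfl, hw⟩
  · rintro ⟨u, rfl, rfl, hu⟩
    exact ⟨⟨(ofDomain S†).symm u, hu, rfl⟩, GraphDom.mem_graph u⟩

theorem le_ext (hS : Dense (S.domain : Set E)) (hsymm : S.IsFormalAdjoint S) (j : Fin 2) :
    S ≤ P.ext j := by
  refine LinearPMap.le_of_le_graph ?_
  rintro ⟨x, x'⟩ hx
  obtain ⟨f, rfl, rfl, hf⟩ := P.exists_Γ_eq_zero hS hsymm hx
  exact P.mem_graph_ext_iff.2 ⟨f, rfl, rfl, hf j⟩

theorem dense_ext_domain (hS : Dense (S.domain : Set E)) (hsymm : S.IsFormalAdjoint S)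
    (j : Fin 2) : Dense ((P.ext j).domain : Set E) :=
  hS.mono (P.le_ext hS hsymm j).1

theorem Γ_eq_zero_iff (j : Fin 2) (u : GraphDom S†) :
    P.Γ j u = 0 ↔ ∀ f, P.Γ j f = 0 →
      inner ℂ (op S† u) (incl S† f) = inner ℂ (incl S† u) (op S† f) := by
  constructor
  · intro hu f hf
    have hgreen := P.neg_one_pow_mul_green j f u
    rw [hu, hf, inner_zero_left, inner_zero_right, sub_zero] at hgreen
    exact (sub_eq_zero.1 ((mul_eq_zero_iff_left (by simp)).1 hgreen)).symm
  · intro hinner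
    obtain ⟨f, hf, hf'⟩ := P.exists_Γ_eq j 0 (P.Γ j u)
    have hgreen := P.neg_one_pow_mul_green j f u
    rw [hinner f hf, hf, hf', sub_self, mul_zero, inner_zero_right, sub_zero] at hgreen
    exact inner_self_eq_zero.1 hgreen.symm

theorem isSelfAdjoint_ext (hS : Dense (S.domain : Set E)) (hsymm : S.IsFormalAdjoint S)
    (j : Fin 2) : IsSelfAdjoint (P.ext j) := by
  rw [LinearPMap.isSelfAdjoint_def]
  refine LinearPMap.eq_of_eq_graph (SetLike.ext ?_)
  rintro ⟨g, g'⟩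
  rw [mem_graph_adjoint_iff (P.dense_ext_domain hS hsymm j), mem_graph_ext_iff]
  constructor
  · intro hinner
    have hg : (g, g') ∈ S†.graph := (mem_graph_adjoint_iff hS).2 fun x x' hx =>
      hinner x x' (LinearPMap.le_graph_of_le (P.le_ext hS hsymm j) hx)
    obtain ⟨u, rfl, rfl⟩ := exists_of_mem_graph hg
    exact ⟨u, rfl, rfl, (P.Γ_eq_zero_iff j u).2 fun f hf =>
      hinner _ _ (P.mem_graph_ext_iff.2 ⟨f, rfl, rfl, hf⟩)⟩
  · rintro ⟨u, rfl, rfl, hu⟩ x x' hx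
    obtain ⟨f, rfl, rfl, hf⟩ := P.mem_graph_ext_iff.1 hx
    exact (P.Γ_eq_zero_iff j u).1 hu f hf

theorem im_inner_Γ_eq {z : ℂ} {f : GraphDom S†} (hf : f ∈ eigenDom S† z) :
    (inner ℂ (P.Γ 0 f) (P.Γ 1 f)).im = z.im * ‖incl S† f‖ ^ 2 := by
  have hgreen := P.green f f
  rw [mem_eigenDom_iff.1 hf, inner_smul_right, inner_smul_left, ← sub_mul, Complex.sub_conj,
    inner_self_eq_norm_sq_to_K, ← inner_conj_symm (P.Γ 1 f), Complex.sub_conj] at hgreen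
  refine Complex.ofReal_injective 
    (mul_left_cancel₀ (mul_ne_zero two_ne_zero Complex.I_ne_zero) ?_)
  push_cast at hgreen ⊢
  linear_combination -hgreen

theorem abs_im_mul_norm_sq_le {z : ℂ} {f : GraphDom S†} (hf : f ∈ eigenDom S† z) :
    |z.im| * ‖incl S† f‖ ^ 2 ≤ ‖P.Γ 0 f‖ * ‖P.Γ 1 f‖ :=
  calc |z.im| * ‖incl S† f‖ ^ 2 = |(inner ℂ (P.Γ 0 f) (P.Γ 1 f)).im| := by
        rw [P.im_inner_Γ_eq hf, abs_mul, abs_of_nonneg (sq_nonneg ‖incl S† f‖)]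
    _ ≤ ‖P.Γ 0 f‖ * ‖P.Γ 1 f‖ := (Complex.abs_im_le_norm _).trans (norm_inner_le_norm _ _)

section Weyl

variable {z : ℂ} (hz : z.im ≠ 0)
include hz

theorem eq_zero_of_mem_eigenDom {f : GraphDom S†} (hf : f ∈ eigenDom S† z) (h₀ : P.Γ 0 f = 0) :
    f = 0 := by
  have him := P.im_inner_Γ_eq hf
  rw [h₀, inner_zero_left, Complex.zero_im, eq_comm, mul_eq_zero_iff_left hz,
    sq_eq_zero_iff, norm_eq_zero] at him
  exact incl_injective (him.trans (map_zero _).symm)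

theorem mem_graph_gammaField_iff {a : G} {f : GraphDom S†} :
    (a, f) ∈ (P.gammaField z).graph ↔ f ∈ eigenDom S† z ∧ P.Γ 0 f = a := by
  have hker : LinearMap.ker ((P.Γ 0 : GraphDom S† →ₗ[ℂ] G).toPMap (eigenDom S† z)).toFun = ⊥ :=
    LinearMap.ker_eq_bot'.2 fun f hf => Subtype.ext (P.eq_zero_of_mem_eigenDom hz f.2 hf)
  rw [gammaField, LinearPMap.inverse_graph hker]
  constructor
  · rintro ⟨⟨x, y⟩, hxy, h⟩
    obtain ⟨rfl, rfl⟩ := Prod.ext_iff.1 h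
    obtain ⟨u, rfl, rfl⟩ := (LinearPMap.mem_graph_iff _).1 hxy
    exact ⟨u.2, rfl⟩
  · rintro ⟨hf, rfl⟩
    exact ⟨(f, P.Γ 0 f),
      ((P.Γ 0 : GraphDom S† →ₗ[ℂ] G).toPMap (eigenDom S† z)).mem_graph ⟨f, hf⟩, rfl⟩

theorem mem_graph_weyl_iff {a b : G} :
    (a, b) ∈ (P.weyl z).graph ↔ ∃ f ∈ eigenDom S† z, P.Γ 0 f = a ∧ P.Γ 1 f = b := by
  constructor
  · intro h
    obtain ⟨u, rfl, rfl⟩ := (P.weyl z).mem_graph_iff.1 h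
    obtain ⟨hf, h₀⟩ := (P.mem_graph_gammaField_iff hz).1 ((P.gammaField z).mem_graph u)
    exact ⟨_, hf, h₀, rfl⟩
  · rintro ⟨f, hf, h₀, rfl⟩
    obtain ⟨u, rfl, rfl⟩ :=
      (P.gammaField z).mem_graph_iff.1 ((P.mem_graph_gammaField_iff hz).2 ⟨hf, h₀⟩)
    exact (P.weyl z).mem_graph u

variable (hS : Dense (S.domain : Set E)) (hsymm : S.IsFormalAdjoint S)
include hS hsymm

theorem exists_mem_eigenDom (a : G) : ∃ f ∈ eigenDom S† z, P.Γ 0 f = a := by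
  obtain ⟨u, hu, -⟩ := P.exists_Γ_eq 0 a 0
  obtain ⟨w, hw⟩ := surjective_opSub (P.isSelfAdjoint_ext hS hsymm 0) hz (opSub S† z u)
  obtain ⟨v, hincl, hop, hv⟩ := P.mem_graph_ext_iff.1 (GraphDom.mem_graph w)
  have hvu : opSub S† z v = opSub S† z u := by
    rw [← hw, opSub_apply, opSub_apply, hincl, hop]
  refine ⟨u - v, ?_, by rw [map_sub, hu, hv, sub_zero]⟩
  exact LinearMap.mem_ker.2 ((map_sub (opSub S† z) u v).trans (sub_eq_zero.2 hvu.symm))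

theorem weyl_domain_eq_top : (P.weyl z).domain = ⊤ := by
  refine Submodule.eq_top_iff'.2 fun a => ?_
  obtain ⟨f, hf, h₀⟩ := P.exists_mem_eigenDom hz hS hsymm a
  exact LinearPMap.mem_domain_of_mem_graph ((P.mem_graph_weyl_iff hz).2 ⟨f, hf, h₀, rfl⟩)

theorem weyl_adjoint [CompleteSpace G] : (P.weyl z)† = P.weyl (conj z) := by
  have hz' : (conj z).im ≠ 0 := by simpa using hz
  have hdom := P.weyl_domain_eq_top hz hS hsymm
  have hdom' := P.weyl_domain_eq_top hz' hS hsymm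
  have hdense : Dense ((P.weyl z).domain : Set G) := by simp [hdom]
  have hle : P.weyl (conj z) ≤ (P.weyl z)† := by
    refine LinearPMap.le_of_le_graph ?_
    rintro ⟨b, b'⟩ hb
    obtain ⟨g, hg, rfl, rfl⟩ := (P.mem_graph_weyl_iff hz').1 hb
    refine (mem_graph_adjoint_iff hdense).2 fun a a' ha => ?_
    obtain ⟨f, hf, rfl, rfl⟩ := (P.mem_graph_weyl_iff hz).1 ha
    have hgreen := P.green f g
    rw [mem_eigenDom_iff.1 hf, mem_eigenDom_iff.1 hg, inner_smul_right, inner_smul_left,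
      Complex.conj_conj, sub_self] at hgreen
    exact (sub_eq_zero.1 hgreen.symm).symm
  refine (LinearPMap.eq_of_le_of_domain_eq hle ?_).symm
  exact hdom'.trans (top_unique (hdom' ▸ hle.1)).symm

theorem exists_weyl_eq_toPMap [CompleteSpace G] :
    ∃ B : G →L[ℂ] G, P.weyl z = (B : G →ₗ[ℂ] G).toPMap ⊤ := by
  have hz' : (conj z).im ≠ 0 := by simpa using hz
  have hdense : Dense ((P.weyl (conj z)).domain : Set G) := by
    simp [P.weyl_domain_eq_top hz' hS hsymm]
  have hclosed : (P.weyl z).IsClosed := by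
    rw [← Complex.conj_conj z, ← P.weyl_adjoint hz' hS hsymm]
    exact LinearPMap.adjoint_isClosed hdense
  exact exists_eq_toPMap_of_isClosed hclosed (P.weyl_domain_eq_top hz hS hsymm)

end Weyl

end BoundaryTriplet

/-! ### Direct sums of boundary triplets -/

section BoundaryRelations

open GraphDom

variable {E : Type*} [NormedAddCommGroup E] [InnerProductSpace ℂ E] [CompleteSpace E]
  {G : Type*} [NormedAddCommGroup G] [InnerProductSpace ℂ G]

theorem mem_weylRelation_iff {A : E →ₗ.[ℂ] E} {Γ : Submodule ℂ (E × (G × G))} {z : ℂ}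
    {y : G × G} : y ∈ weylRelation A Γ z ↔ ∃ f ∈ eigenDom A† z, (incl A† f, y) ∈ Γ := by
  constructor
  · rintro ⟨⟨x, y⟩, ⟨hxy, f, hf, rfl⟩, rfl⟩
    exact ⟨f, hf, hxy⟩
  · rintro ⟨f, hf, hfy⟩
    exact ⟨(incl A† f, y), ⟨hfy, f, hf, rfl⟩, rfl⟩

end BoundaryRelations

section SumOfTriplets

open GraphDom

theorem forall_fin_two_iff_and_one_sub {p : Fin 2 → Prop} (j : Fin 2) :
    (∀ i, p i) ↔ p j ∧ p (1 - j) := by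
  fin_cases j <;> simp [Fin.forall_fin_two, and_comm]

variable {H : ℕ → Type*} {K : ℕ → Type*}
  [∀ n, NormedAddCommGroup (H n)] [∀ n, InnerProductSpace ℂ (H n)] [∀ n, CompleteSpace (H n)]
  [∀ n, NormedAddCommGroup (K n)] [∀ n, InnerProductSpace ℂ (K n)]
  {S : ∀ n, H n →ₗ.[ℂ] H n} (P : ∀ n, BoundaryTriplet (S n) (K n))

theorem incl_mem_sumΓRel_iff {f : GraphDom (directSum S)†} {y : lp K 2 × lp K 2} :
    (incl (directSum S)† f, y) ∈ sumΓRel P ↔ (f, y) ∈ (sumΓPair P).graph := by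
  constructor
  · rintro ⟨⟨g, y⟩, hg, h⟩
    obtain ⟨hgf, rfl⟩ := Prod.ext_iff.1 h
    obtain rfl := incl_injective hgf
    exact hg
  · exact fun h => ⟨(f, y), h, rfl⟩

theorem exists_incl_eq_of_mem_sumΓRel {x : lp H 2} {y : lp K 2 × lp K 2}
    (h : (x, y) ∈ sumΓRel P) : ∃ f : GraphDom (directSum S)†, incl (directSum S)† f = x := by
  obtain ⟨⟨f, y⟩, -, hf⟩ := h
  exact ⟨f, congrArg Prod.fst hf⟩

theorem sumΓRel_snd_unique {x : lp H 2} {y₁ y₂ : lp K 2 × lp K 2}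
    (h₁ : (x, y₁) ∈ sumΓRel P) (h₂ : (x, y₂) ∈ sumΓRel P) : y₁ = y₂ := by
  obtain ⟨f, rfl⟩ := exists_incl_eq_of_mem_sumΓRel P h₁
  exact (sumΓPair P).mem_graph_snd_inj ((incl_mem_sumΓRel_iff P).1 h₁)
    ((incl_mem_sumΓRel_iff P).1 h₂) rfl

theorem mem_graph_sumΓPair_iff_mem_graph_sumΓ {f : GraphDom (directSum S)†}
    {y : lp K 2 × lp K 2} :
    (f, y) ∈ (sumΓPair P).graph ↔ (f, y.1) ∈ (sumΓ P 0).graph ∧ (f, y.2) ∈ (sumΓ P 1).graph := by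
  constructor
  · intro h
    obtain ⟨u, rfl, rfl⟩ := (sumΓPair P).mem_graph_iff.1 h
    exact ⟨(sumΓ P 0).mem_graph ⟨u.1, u.2.1⟩, (sumΓ P 1).mem_graph ⟨u.1, u.2.2⟩⟩
  · rintro ⟨h₀, h₁⟩
    have hf : f ∈ (sumΓPair P).domain :=
      ⟨LinearPMap.mem_domain_of_mem_graph h₀, LinearPMap.mem_domain_of_mem_graph h₁⟩
    exact (sumΓPair P).mem_graph_iff.2 ⟨⟨f, hf⟩, rfl, Prod.ext
      ((LinearPMap.image_iff _).2 h₀).symm ((LinearPMap.image_iff _).2 h₁).symm⟩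

variable (hdense : ∀ n, Dense ((S n).domain : Set (H n)))

/-- The sequence `n ↦ Γ_j^(n) (f n)` of boundary values of `f ∈ dom A†`, `A = ⨁ S n`, whether
square-summable or not; `f` lies in the domain of `Γ_j` exactly when it is. -/
def boundaryValues (j : Fin 2) : GraphDom (directSum S)† →ₗ[ℂ] ∀ n, K n :=
  LinearMap.pi fun n =>
    ((P n).Γ j : GraphDom (S n)† →ₗ[ℂ] K n) ∘ₗ comp (adjoint_directSum hdense) n

theorem boundaryValues_apply (j : Fin 2) (f : GraphDom (directSum S)†) (n : ℕ) :
    boundaryValues P hdense j f n = (P n).Γ j (comp (adjoint_directSum hdense) n f) := rfl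

theorem boundaryValues_single (j : Fin 2) (n : ℕ) (u : GraphDom (S n)†) :
    boundaryValues P hdense j (single (adjoint_directSum hdense) n u)
      = lp.single (E := K) 2 n ((P n).Γ j u) := by
  funext m
  rw [boundaryValues_apply]
  rcases eq_or_ne m n with rfl | hm
  · rw [comp_single_same, lp.single_apply_self]
  · rw [comp_single_of_ne _ hm, map_zero, lp.single_apply_ne _ _ _ hm]

theorem continuous_boundaryValues (j : Fin 2) : Continuous (boundaryValues P hdense j) :=
  continuous_pi fun n => ((P n).Γ j).continuous.comp (continuous_comp _ n)

theorem mem_graph_sumΓ_iff {j : Fin 2} {f : GraphDom (directSum S)†} {h : lp K 2} :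
    (f, h) ∈ (sumΓ P j).graph ↔ boundaryValues P hdense j f = h := by
  have hincl : (f, h) ∈ (sumΓ P j).graph ↔
      (incl (directSum S)† f, h) ∈ (directSum fun n => (P n).ΓPMap j).graph := by
    rw [LinearPMap.mem_graph_iff, LinearPMap.mem_graph_iff]
    constructor
    · rintro ⟨u, rfl, rfl⟩
      exact ⟨⟨_, u.2⟩, rfl, rfl⟩
    · rintro ⟨⟨u, hu⟩, rfl, hu'⟩
      exact ⟨⟨f, hu⟩, rfl, hu'⟩
  rw [hincl, mem_graph_directSum_iff, funext_iff]
  refine forall_congr' fun n => ?_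
  rw [LinearPMap.mem_graph_iff, boundaryValues_apply]
  constructor
  · rintro ⟨u, hu, hu'⟩
    obtain rfl : u = (ofDomain _).symm (comp (adjoint_directSum hdense) n f) := Subtype.ext hu
    exact hu'
  · intro hn
    exact ⟨(ofDomain _).symm (comp (adjoint_directSum hdense) n f), rfl, hn⟩

theorem mem_domain_sumΓ_iff {j : Fin 2} {f : GraphDom (directSum S)†} :
    f ∈ (sumΓ P j).domain ↔ Memℓp (boundaryValues P hdense j f) 2 := by
  simp only [LinearPMap.mem_domain_iff, mem_graph_sumΓ_iff P hdense]
  exact ⟨fun ⟨h, hh⟩ => hh ▸ lp.memℓp h, fun hf => ⟨⟨_, hf⟩, rfl⟩⟩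

theorem mem_graph_sumΓPair_iff {f : GraphDom (directSum S)†} {y : lp K 2 × lp K 2} :
    (f, y) ∈ (sumΓPair P).graph ↔
      boundaryValues P hdense 0 f = y.1 ∧ boundaryValues P hdense 1 f = y.2 := by
  rw [mem_graph_sumΓPair_iff_mem_graph_sumΓ, mem_graph_sumΓ_iff, mem_graph_sumΓ_iff]

theorem single_mem_graph_sumΓPair (n : ℕ) (u : GraphDom (S n)†) :
    (single (adjoint_directSum hdense) n u,
      (lp.single 2 n ((P n).Γ 0 u), lp.single 2 n ((P n).Γ 1 u))) ∈ (sumΓPair P).graph :=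
  (mem_graph_sumΓPair_iff P hdense).2
    ⟨boundaryValues_single P hdense 0 n u, boundaryValues_single P hdense 1 n u⟩

theorem mem_domain_sumΓPair_iff {f : GraphDom (directSum S)†} :
    f ∈ (sumΓPair P).domain ↔ ∀ i, Memℓp (boundaryValues P hdense i f) 2 := by
  simp only [← mem_domain_sumΓ_iff P hdense, Fin.forall_fin_two]
  exact Iff.rfl

theorem mem_graph_astarExt_iff {j : Fin 2} {x y : lp H 2} :
    (x, y) ∈ (AstarExt P j).graph ↔ ∃ f : GraphDom (directSum S)†,
      incl (directSum S)† f = x ∧ op (directSum S)† f = y ∧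
      boundaryValues P hdense j f = 0 ∧ Memℓp (boundaryValues P hdense (1 - j) f) 2 := by
  have hker (f) : f ∈ pmapKer (sumΓ P j) ↔ boundaryValues P hdense j f = 0 :=
    mem_pmapKer_iff.trans (mem_graph_sumΓ_iff P hdense)
  rw [AstarExt, mem_graph_domRestrict_iff, Astar, mem_graph_domRestrict_iff]
  constructor
  · rintro ⟨⟨f, hf, rfl⟩, ⟨g, hg, hgf⟩, h⟩
    obtain rfl := incl_injective hgf
    exact ⟨g, rfl, (eq_op_of_mem_graph h).symm, (hker g).1 hf,
      (mem_domain_sumΓPair_iff P hdense).1 hg (1 - j)⟩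
  · rintro ⟨f, rfl, rfl, hf, hf'⟩
    have hfj : Memℓp (boundaryValues P hdense j f) 2 := hf ▸ zero_memℓp
    exact ⟨⟨f, (hker f).2 hf, rfl⟩, ⟨f, (mem_domain_sumΓPair_iff P hdense).2
      ((forall_fin_two_iff_and_one_sub j).2 ⟨hfj, hf'⟩), rfl⟩, mem_graph f⟩

theorem mem_graph_atilde_iff {j : Fin 2} {x y : lp H 2} :
    (x, y) ∈ (Atilde P j).graph ↔ ∃ f : GraphDom (directSum S)†,
      incl (directSum S)† f = x ∧ op (directSum S)† f = y ∧
      boundaryValues P hdense j f = 0 := by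
  rw [Atilde, mem_graph_directSum_iff]
  constructor
  · intro h
    choose u hx hy hu using fun n => (P n).mem_graph_ext_iff.1 (h n)
    obtain ⟨f, rfl, rfl, hf⟩ := exists_comp_eq (adjoint_directSum hdense) u hx hy
    refine ⟨f, rfl, rfl, funext fun n => ?_⟩
    rw [boundaryValues_apply, hf, hu, Pi.zero_apply]
  · rintro ⟨f, rfl, rfl, hf⟩ n
    exact (P n).mem_graph_ext_iff.2
      ⟨comp (adjoint_directSum hdense) n f, rfl, op_comp (adjoint_directSum hdense) n f,
        congrFun hf n⟩

theorem exists_boundaryValues_eq_zero_of_mem_domain_atilde {j : Fin 2} {x : lp H 2}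
    (hx : x ∈ (Atilde P j).domain) : ∃ f : GraphDom (directSum S)†,
      incl (directSum S)† f = x ∧ boundaryValues P hdense j f = 0 := by
  obtain ⟨y, hy⟩ := LinearPMap.mem_domain_iff.1 hx
  obtain ⟨f, hf, -, hf₀⟩ := (mem_graph_atilde_iff P hdense).1 hy
  exact ⟨f, hf, hf₀⟩

theorem SupFinite.memℓp_boundaryValues {P : ∀ n, BoundaryTriplet (S n) (K n)} {j : Fin 2}
    (h : SupFinite P j) (f : GraphDom (directSum S)†) :
    Memℓp (boundaryValues P hdense j f) 2 := by
  obtain ⟨C, hC⟩ := h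
  rw [memℓp_two_iff]
  refine Summable.of_nonneg_of_le (fun n => sq_nonneg _) (fun n => ?_)
    ((summable_norm_comp_sq (adjoint_directSum hdense) f).mul_left (C ^ 2))
  rw [← mul_pow]
  exact pow_le_pow_left₀ (norm_nonneg _) (((P n).Γ j).le_of_opNorm_le (hC ⟨n, rfl⟩) _) 2

include hdense in
theorem green_of_mem_graph_sumΓPair {f g : GraphDom (directSum S)†} {l l' h h' : lp K 2}
    (hf : (f, (l, l')) ∈ (sumΓPair P).graph) (hg : (g, (h, h')) ∈ (sumΓPair P).graph) :
    inner ℂ (incl (directSum S)† g) (op (directSum S)† f)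
        - inner ℂ (op (directSum S)† g) (incl (directSum S)† f)
      = inner ℂ h l' - inner ℂ h' l := by
  obtain ⟨hf₀, hf₁⟩ := (mem_graph_sumΓPair_iff P hdense).1 hf
  obtain ⟨hg₀, hg₁⟩ := (mem_graph_sumΓPair_iff P hdense).1 hg
  have hgreen (n) : inner ℂ (incl (directSum S)† g n) (op (directSum S)† f n)
        - inner ℂ (op (directSum S)† g n) (incl (directSum S)† f n)
      = inner ℂ (h n) (l' n) - inner ℂ (h' n) (l n) := by
    rw [← op_comp (adjoint_directSum hdense), ← op_comp (adjoint_directSum hdense), ← hf₀, ← hf₁,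
      ← hg₀, ← hg₁]
    exact (P n).green (comp (adjoint_directSum hdense) n f) (comp (adjoint_directSum hdense) n g)
  have hleft := (lp.hasSum_inner (𝕜 := ℂ) (incl (directSum S)† g) (op (directSum S)† f)).sub
    (lp.hasSum_inner (𝕜 := ℂ) (op (directSum S)† g) (incl (directSum S)† f))
  have hright := (lp.hasSum_inner (𝕜 := ℂ) h l').sub (lp.hasSum_inner (𝕜 := ℂ) h' l)
  rw [← funext hgreen] at hright
  exact hleft.unique hright

section Density

include hdense

theorem dense_sumΓPair_domain :
    Dense ((sumΓPair P).domain : Set (GraphDom (directSum S)†)) := by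
  suffices h : ∀ f, f ∈ (sumΓPair P).domain.topologicalClosure from h
  refine fun f => mem_topologicalClosure_of_hasSum (fun n => ?_)
    (hasSum_single_comp (adjoint_directSum hdense) f)
  exact Submodule.le_topologicalClosure _
    (LinearPMap.mem_domain_of_mem_graph (single_mem_graph_sumΓPair P hdense n _))

theorem dense_range_sumΓPair : Dense (Set.range (sumΓPair P)) := by
  suffices h : ∀ y, y ∈ (LinearMap.range (sumΓPair P).toFun).topologicalClosure from h
  refine fun y => mem_topologicalClosure_of_hasSum (fun n => ?_)
    ((lp.hasSum_single (by simp) y.1).prodMk (lp.hasSum_single (by simp) y.2))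
  refine Submodule.le_topologicalClosure _ (LinearPMap.mem_range_iff.2 ?_)
  obtain ⟨u, h₀, h₁⟩ : ∃ u, (P n).Γ 0 u = y.1 n ∧ (P n).Γ 1 u = y.2 n :=
    (P n).exists_Γ_eq 0 (y.1 n) (y.2 n)
  exact ⟨_, h₀ ▸ h₁ ▸ single_mem_graph_sumΓPair P hdense n u⟩

end Density

section BoundaryRelation

variable (hsymm : ∀ n, (S n).IsFormalAdjoint (S n))
include hdense hsymm

theorem mem_sumΓRel_of_green {g g' : lp H 2} {h h' : lp K 2}
    (hgreen : ∀ (f : GraphDom (directSum S)†) (l l' : lp K 2),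
      (incl (directSum S)† f, (l, l')) ∈ sumΓRel P →
      inner ℂ g (op (directSum S)† f) - inner ℂ g' (incl (directSum S)† f)
        = inner ℂ h l' - inner ℂ h' l) :
    (g, (h, h')) ∈ sumΓRel P := by
  have hcomp (n) : ∃ u : GraphDom (S n)†, incl (S n)† u = g n ∧ op (S n)† u = g' n ∧
      (P n).Γ 0 u = h n ∧ (P n).Γ 1 u = h' n := by
    refine (P n).exists_of_green (hdense n) (hsymm n) fun u => ?_
    simpa only [op_single, incl_single, lp.inner_single_right] using
      hgreen _ _ _ ((incl_mem_sumΓRel_iff P).2 (single_mem_graph_sumΓPair P hdense n u))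
  choose u hg hg' h₀ h₁ using hcomp
  obtain ⟨f, rfl, -, hf⟩ := exists_comp_eq (adjoint_directSum hdense) u hg hg'
  refine (incl_mem_sumΓRel_iff P).2 ((mem_graph_sumΓPair_iff P hdense).2 ⟨?_, ?_⟩)
  · exact funext fun n => by rw [boundaryValues_apply, hf, h₀]
  · exact funext fun n => by rw [boundaryValues_apply, hf, h₁]

theorem isBoundaryRelation_sumΓRel : IsBoundaryRelation (directSum S) (sumΓRel P) where
  dense_domain := dense_directSum_domain hdense
  symmetric := isFormalAdjoint_directSum hsymm
  dom_le := by
    rintro - ⟨⟨x, y⟩, hxy, rfl⟩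
    obtain ⟨f, rfl⟩ := exists_incl_eq_of_mem_sumΓRel P hxy
    exact incl_mem_domain f
  dense := (dense_sumΓPair_domain P hdense).mono fun f hf =>
    ⟨_, (incl_mem_sumΓRel_iff P).2 ((sumΓPair P).mem_graph ⟨f, hf⟩), rfl⟩
  green f g l l' h h' hf hg := green_of_mem_graph_sumΓPair P hdense
    ((incl_mem_sumΓRel_iff P).1 hf) ((incl_mem_sumΓRel_iff P).1 hg)
  maximal _ _ _ _ hgreen := mem_sumΓRel_of_green P hdense hsymm hgreen

end BoundaryRelation

section WeylFunction

variable {z : ℂ} (hz : z.im ≠ 0)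
include hz

theorem memℓp_incl_of_mem_eigenDom {P : ∀ n, BoundaryTriplet (S n) (K n)}
    {u : ∀ n, GraphDom (S n)†} (hu : ∀ n, u n ∈ eigenDom (S n)† z)
    (h₀ : Memℓp (fun n => (P n).Γ 0 (u n)) 2) (h₁ : Memℓp (fun n => (P n).Γ 1 (u n)) 2) :
    Memℓp (fun n => incl (S n)† (u n)) 2 := by
  rw [memℓp_two_iff] at h₀ h₁ ⊢
  refine Summable.of_nonneg_of_le (fun n => sq_nonneg _) (fun n => ?_)
    ((h₀.add h₁).div_const |z.im|)
  rw [le_div_iff₀' (abs_pos.2 hz)]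
  have hle := (P n).abs_im_mul_norm_sq_le (hu n)
  linarith [two_mul_le_add_sq ‖(P n).Γ 0 (u n)‖ ‖(P n).Γ 1 (u n)‖,
    mul_nonneg (norm_nonneg ((P n).Γ 0 (u n))) (norm_nonneg ((P n).Γ 1 (u n)))]

include hdense in
theorem weylRelation_sumΓRel :
    weylRelation (directSum S) (sumΓRel P) z = (directSum fun n => (P n).weyl z).graph := by
  refine SetLike.ext ?_
  rintro ⟨h, h'⟩
  simp only [mem_weylRelation_iff, incl_mem_sumΓRel_iff, mem_graph_sumΓPair_iff P hdense,
    mem_graph_directSum_iff, fun n => (P n).mem_graph_weyl_iff hz]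
  constructor
  · rintro ⟨f, hf, h₀, h₁⟩ n
    exact ⟨comp (adjoint_directSum hdense) n f,
      (mem_eigenDom_iff_comp (adjoint_directSum hdense)).1 hf n, congrFun h₀ n, congrFun h₁ n⟩
  · intro hcomp
    choose u hu h₀ h₁ using hcomp
    have hsum : Memℓp (fun n => incl (S n)† (u n)) 2 :=
      memℓp_incl_of_mem_eigenDom hz hu ((funext h₀).symm ▸ lp.memℓp h)
        ((funext h₁).symm ▸ lp.memℓp h')
    obtain ⟨f, hf, hfu⟩ := exists_mem_eigenDom_comp_eq (adjoint_directSum hdense) hu hsum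
    refine ⟨f, hf, funext fun n => ?_, funext fun n => ?_⟩
    · rw [boundaryValues_apply, hfu, h₀]
    · rw [boundaryValues_apply, hfu, h₁]

end WeylFunction

section Boundedness

include hdense

theorem isClosed_sumΓ (j : Fin 2) : (sumΓ P j).IsClosed := by
  have hgraph : ((sumΓ P j).graph : Set (GraphDom (directSum S)† × lp K 2))
      = {p | boundaryValues P hdense j p.1 = p.2} :=
    Set.ext fun _ => mem_graph_sumΓ_iff P hdense
  rw [LinearPMap.IsClosed, hgraph]
  exact isClosed_eq ((continuous_boundaryValues P hdense j).comp continuous_fst)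
    (lp.uniformContinuous_coe.continuous.comp continuous_snd)

theorem isClosed_sumΓPair : (sumΓPair P).IsClosed := by
  have hgraph : ((sumΓPair P).graph : Set (GraphDom (directSum S)† × (lp K 2 × lp K 2)))
      = (fun p => (p.1, p.2.1)) ⁻¹' (sumΓ P 0).graph ∩
        (fun p => (p.1, p.2.2)) ⁻¹' (sumΓ P 1).graph :=
    Set.ext fun _ => mem_graph_sumΓPair_iff_mem_graph_sumΓ P
  rw [LinearPMap.IsClosed, hgraph]
  exact (IsClosed.preimage (by fun_prop) (isClosed_sumΓ P hdense 0)).inter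
    (IsClosed.preimage (by fun_prop) (isClosed_sumΓ P hdense 1))

theorem supFinite_of_sumΓ_eq_toPMap {j : Fin 2} {B : GraphDom (directSum S)† →L[ℂ] lp K 2}
    (h : sumΓ P j = (B : GraphDom (directSum S)† →ₗ[ℂ] lp K 2).toPMap ⊤) : SupFinite P j := by
  refine ⟨‖B‖, Set.forall_mem_range.2 fun n => ?_⟩
  refine ContinuousLinearMap.opNorm_le_bound _ (norm_nonneg B) fun u => ?_
  set f := single (adjoint_directSum hdense) n u
  have hfB : (f, B f) ∈ (sumΓ P j).graph := h ▸
    ((B : GraphDom (directSum S)† →ₗ[ℂ] lp K 2).toPMap ⊤).mem_graph ⟨f, Submodule.mem_top⟩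
  have hBf : B f = lp.single 2 n ((P n).Γ j u) := lp.ext <|
    ((mem_graph_sumΓ_iff P hdense).1 hfB).symm.trans (boundaryValues_single P hdense j n u)
  calc ‖(P n).Γ j u‖ = ‖B f‖ := by rw [hBf, lp.norm_single (by simp)]
    _ ≤ ‖B‖ * ‖f‖ := B.le_opNorm f
    _ = ‖B‖ * ‖u‖ := by rw [norm_single]

variable [∀ n, CompleteSpace (K n)]

theorem closure_sumΓ_tfae (j : Fin 2) : List.TFAE [
    (sumΓ P j).closure.domain = ⊤,
    ∃ B : GraphDom (directSum S)† →L[ℂ] lp K 2,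
      (sumΓ P j).closure = (B : GraphDom (directSum S)† →ₗ[ℂ] lp K 2).toPMap ⊤,
    SupFinite P j] := by
  have : CompleteSpace (GraphDom (directSum S)†) :=
    GraphDom.completeSpace (LinearPMap.adjoint_isClosed (dense_directSum_domain hdense))
  have hclosed := isClosed_sumΓ P hdense j
  rw [closure_eq_of_isClosed hclosed]
  tfae_have 1 → 2 := exists_eq_toPMap_of_isClosed hclosed
  tfae_have 2 → 3 := fun ⟨_, hB⟩ => supFinite_of_sumΓ_eq_toPMap P hdense hB
  tfae_have 3 → 1 := fun h => Submodule.eq_top_iff'.2 fun f =>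
    (mem_domain_sumΓ_iff P hdense).2 (h.memℓp_boundaryValues hdense f)
  tfae_finish

theorem domain_sumΓ_eq_top_iff {j : Fin 2} : (sumΓ P j).domain = ⊤ ↔ SupFinite P j := by
  have htfae := closure_sumΓ_tfae P hdense j
  rw [closure_eq_of_isClosed (isClosed_sumΓ P hdense j)] at htfae
  exact htfae.out 0 2

theorem domain_sumΓPair_eq_top_iff :
    (sumΓPair P).domain = ⊤ ↔ SupFinite P 0 ∧ SupFinite P 1 := by
  rw [← domain_sumΓ_eq_top_iff P hdense, ← domain_sumΓ_eq_top_iff P hdense]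
  exact inf_eq_top_iff

end Boundedness

section Extensions

theorem exists_add_eq_of_isTransversal
    (ht : IsTransversal (directSum S) (Atilde P 0) (Atilde P 1)) (j : Fin 2)
    (f : GraphDom (directSum S)†) : ∃ g h : GraphDom (directSum S)†, g + h = f ∧
      boundaryValues P hdense j g = 0 ∧ boundaryValues P hdense (1 - j) h = 0 := by
  have hsup : (Atilde P j).domain ⊔ (Atilde P (1 - j)).domain = (directSum S)†.domain := by
    rw [← ht.sup_eq]
    fin_cases j
    · rfl
    · exact sup_comm _ _
  obtain ⟨x, hx, y, hy, hxy⟩ := Submodule.mem_sup.1 (hsup ▸ incl_mem_domain f)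
  obtain ⟨g, rfl, hg⟩ := exists_boundaryValues_eq_zero_of_mem_domain_atilde P hdense hx
  obtain ⟨h, rfl, hh⟩ := exists_boundaryValues_eq_zero_of_mem_domain_atilde P hdense hy
  exact ⟨g, h, incl_injective ((map_add _ g h).trans hxy), hg, hh⟩

include hdense

theorem astarExt_le_atilde (j : Fin 2) : AstarExt P j ≤ Atilde P j := by
  refine LinearPMap.le_of_le_graph ?_
  rintro ⟨x, y⟩ hxy
  obtain ⟨f, rfl, rfl, hf, -⟩ := (mem_graph_astarExt_iff P hdense).1 hxy
  exact (mem_graph_atilde_iff P hdense).2 ⟨f, rfl, rfl, hf⟩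

theorem astarExt_eq_atilde {j : Fin 2} (h : SupFinite P (1 - j)) : AstarExt P j = Atilde P j := by
  refine le_antisymm (astarExt_le_atilde P hdense j) (LinearPMap.le_of_le_graph ?_)
  rintro ⟨x, y⟩ hxy
  obtain ⟨f, rfl, rfl, hf⟩ := (mem_graph_atilde_iff P hdense).1 hxy
  exact (mem_graph_astarExt_iff P hdense).2
    ⟨f, rfl, rfl, hf, h.memℓp_boundaryValues hdense f⟩

theorem graph_atilde_le_topologicalClosure (j : Fin 2) :
    (Atilde P j).graph ≤ (AstarExt P j).graph.topologicalClosure := by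
  rintro ⟨x, y⟩ hxy
  obtain ⟨f, rfl, rfl, hf⟩ := (mem_graph_atilde_iff P hdense).1 hxy
  refine mem_topologicalClosure_of_hasSum (fun n => ?_)
    ((lp.hasSum_single (by simp) _).prodMk (lp.hasSum_single (by simp) _))
  refine Submodule.le_topologicalClosure _ ((mem_graph_astarExt_iff P hdense).2
    ⟨single (adjoint_directSum hdense) n (comp (adjoint_directSum hdense) n f), rfl, ?_, ?_, ?_⟩)
  · rw [op_single, op_comp (adjoint_directSum hdense) n f]
  · rw [boundaryValues_single, ← boundaryValues_apply P hdense, hf, Pi.zero_apply, lp.single_zero]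
    rfl
  · rw [boundaryValues_single]
    exact lp.memℓp _

variable (hsymm : ∀ n, (S n).IsFormalAdjoint (S n))
include hsymm

theorem isSelfAdjoint_atilde (j : Fin 2) : IsSelfAdjoint (Atilde P j) := by
  rw [LinearPMap.isSelfAdjoint_def, Atilde,
    adjoint_directSum fun n => (P n).dense_ext_domain (hdense n) (hsymm n) j]
  exact congrArg directSum (funext fun n => (P n).isSelfAdjoint_ext (hdense n) (hsymm n) j)

theorem isClosable_astarExt (j : Fin 2) : (AstarExt P j).IsClosable :=
  (isSelfAdjoint_atilde P hdense hsymm j).isClosed.isClosable.leIsClosable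
    (astarExt_le_atilde P hdense j)

theorem closure_astarExt (j : Fin 2) : (AstarExt P j).closure = Atilde P j := by
  have hclosed := (isSelfAdjoint_atilde P hdense hsymm j).isClosed
  refine le_antisymm ?_ (LinearPMap.le_of_le_graph ?_)
  · rw [← closure_eq_of_isClosed hclosed]
    exact hclosed.isClosable.closure_mono (astarExt_le_atilde P hdense j)
  · rw [← (isClosable_astarExt P hdense hsymm j).graph_closure_eq_closure_graph]
    exact graph_atilde_le_topologicalClosure P hdense j

theorem isEssentiallySelfAdjoint_astarExt (j : Fin 2) :
    IsEssentiallySelfAdjoint (AstarExt P j) := by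
  refine ⟨isClosable_astarExt P hdense hsymm j, ?_⟩
  rw [closure_astarExt P hdense hsymm]
  exact isSelfAdjoint_atilde P hdense hsymm j

theorem isSelfAdjoint_astarExt {j : Fin 2} (h : SupFinite P (1 - j)) :
    IsSelfAdjoint (AstarExt P j) := by
  rw [astarExt_eq_atilde P hdense h]
  exact isSelfAdjoint_atilde P hdense hsymm j

theorem supFinite_of_isSelfAdjoint_astarExt [∀ n, CompleteSpace (K n)]
    (ht : IsTransversal (directSum S) (Atilde P 0) (Atilde P 1)) {j : Fin 2}
    (h : IsSelfAdjoint (AstarExt P j)) : SupFinite P (1 - j) := by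
  have heq : AstarExt P j = Atilde P j :=
    (closure_eq_of_isClosed h.isClosed).symm.trans (closure_astarExt P hdense hsymm j)
  rw [← domain_sumΓ_eq_top_iff P hdense, Submodule.eq_top_iff']
  intro f
  obtain ⟨g, k, rfl, hg, hk⟩ := exists_add_eq_of_isTransversal P hdense ht j f
  have hgraph : (incl (directSum S)† g, op (directSum S)† g) ∈ (AstarExt P j).graph :=
    heq ▸ (mem_graph_atilde_iff P hdense).2 ⟨g, rfl, rfl, hg⟩
  obtain ⟨u, hu, -, -, hsum⟩ := (mem_graph_astarExt_iff P hdense).1 hgraph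
  obtain rfl := incl_injective hu
  rw [mem_domain_sumΓ_iff P hdense, map_add, hk, add_zero]
  exact hsum

end Extensions

end SumOfTriplets

end DirectSumTriplets

end

open DirectSumTriplets in
theorem theorem3p1 {H : ℕ → Type*} {K : ℕ → Type*}
    [∀ n, NormedAddCommGroup (H n)] [∀ n, InnerProductSpace ℂ (H n)] [∀ n, CompleteSpace (H n)]
    [∀ n, NormedAddCommGroup (K n)] [∀ n, InnerProductSpace ℂ (K n)] [∀ n, CompleteSpace (K n)]
    (S : ∀ n, H n →ₗ.[ℂ] H n)
    (hdense : ∀ n, Dense ((S n).domain : Set (H n)))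
    (hsymm : ∀ n, (S n).IsFormalAdjoint (S n))
    (P : ∀ n, BoundaryTriplet (S n) (K n)) :
    -- the adjoint of `A = ⨁ S n`
    (directSum S)† = directSum (fun n => (S n)†) ∧
    -- (i) `Γ` is a single-valued boundary relation for `A†`
    (IsBoundaryRelation (directSum S) (sumΓRel P) ∧
      ∀ f y₁ y₂, (f, y₁) ∈ sumΓRel P → (f, y₂) ∈ sumΓRel P → y₁ = y₂) ∧
    -- (ii) the Weyl function of `Γ` is the direct sum of the bounded operators `M_n(z)`
    (∀ z : ℂ, z.im ≠ 0 →
      (∀ n, ∃ B : K n →L[ℂ] K n, (P n).weyl z = (B : K n →ₗ[ℂ] K n).toPMap ⊤) ∧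
      weylRelation (directSum S) (sumΓRel P) z = (directSum fun n => (P n).weyl z).graph) ∧
    -- (iii) the range of `Γ` is dense
    Dense (Set.range (sumΓPair P)) ∧
    -- (iv) `Γ` is closed, and the `Γ_j` are closable
    ((sumΓPair P).IsClosed ∧ ∀ j, (sumΓ P j).IsClosable) ∧
    -- (v) boundedness of the closures
    ((∀ j, List.TFAE [
        (sumΓ P j).closure.domain = ⊤,
        ∃ B : GraphDom (directSum S)† →L[ℂ] lp K 2,
          (sumΓ P j).closure = (B : GraphDom (directSum S)† →ₗ[ℂ] lp K 2).toPMap ⊤,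
        SupFinite P j]) ∧
      ((sumΓPair P).domain = ⊤ ↔ SupFinite P 0 ∧ SupFinite P 1)) ∧
    -- (vi) essential self-adjointness
    (∀ j, IsEssentiallySelfAdjoint (AstarExt P j) ∧ (AstarExt P j).closure = Atilde P j) ∧
    -- (vii) self-adjointness; the other index is `j' = 1 - j`
    (∀ j, (SupFinite P (1 - j) → IsSelfAdjoint (AstarExt P j) ∧ AstarExt P j = Atilde P j) ∧
      (IsTransversal (directSum S) (Atilde P 0) (Atilde P 1) →
        (IsSelfAdjoint (AstarExt P j) ↔ SupFinite P (1 - j)))) := by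
  refine ⟨adjoint_directSum hdense,
    ⟨isBoundaryRelation_sumΓRel P hdense hsymm, fun _ _ _ => sumΓRel_snd_unique P⟩,
    fun z hz => ⟨fun n => (P n).exists_weyl_eq_toPMap hz (hdense n) (hsymm n),
      weylRelation_sumΓRel P hdense hz⟩,
    dense_range_sumΓPair P hdense,
    ⟨isClosed_sumΓPair P hdense, fun j => (isClosed_sumΓ P hdense j).isClosable⟩,
    ⟨closure_sumΓ_tfae P hdense, domain_sumΓPair_eq_top_iff P hdense⟩,
    fun j => ⟨isEssentiallySelfAdjoint_astarExt P hdense hsymm j,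
      closure_astarExt P hdense hsymm j⟩,
    fun j => ⟨fun h => ⟨isSelfAdjoint_astarExt P hdense hsymm h,
      astarExt_eq_atilde P hdense h⟩, fun ht => ⟨?_, ?_⟩⟩⟩
  · exact supFinite_of_isSelfAdjoint_astarExt P hdense hsymm ht
  · exact isSelfAdjoint_astarExt P hdense hsymm
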